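/- **Setting.** Let $X=L^2([0,1]^2)$ and let $Y$ be a real Hilbert space with an orthonormal basis $\{\varphi_j\}_{j\ge1}$. For $\phi,\psi:\mathbb R\to\mathbb R$ supported in $[0,1]$ let $\psi_{j,k}^{(t)}(x)=2^j\psi^{(t)}(2^jx-k)$ with $\psi^{(v)}=\phi\otimes\psi$, $\psi^{(h)}=\psi\otimes\phi$, $\psi^{(d)}=\psi\otimes\psi$, $\psi^{(f)}=\phi\otimes\phi$. Assume that the functions $\psi_I=\psi_{j,k}^{(t)}$ with $j\ge J_0$, $k\in\{0,\dots,2^j-1\}^2$, $t\in\{v,h,d\}$, or $t\in\{v,h,d,f\}$ if $j=J_0$, form an orthonormal basis of $X$. Let $Wu=((u,\psi_I)_X)_I\in\ell^2$. Fix $J>J_0$, let $X_p$ be the span of the $p=2^{2J}$ wavelets of scale $j<J$, and identify $\mathbb R^p$ with the sequences in $\ell^2$ that vanish at the scales $j\ge J$. A subband is a pair $s=(j,t)$ occurring among these $p$ wavelets. Let $A:X\to Y$ be linear, bounded and injective, and let $A^*A$ be convolutional: there is $K:\mathbb R^2\to\mathbb R$ such that, for all $I,I'$, with absolutely convergent integrals,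 $$(A^*A\psi_I,\psi_{I'})_X=\int\!\!\int K(x-x')\psi_I(x)\psi_{I'}(x')\,dx\,dx'.$$ Let $\mathbb P_q$ be the orthogonal projection onto $Y_q=\operatorname{span}\{\varphi_1,\dots,\varphi_q\}$, let $\widetilde{\mathbb P}_p$ be the one onto $X_p$, and $A_{p,q}=\mathbb P_qA\widetilde{\mathbb P}_p$. **Network.** A filter from the subband $s=(j,t)$ to $s'=(j',t')$ is an array $F$ indexed by $d\in\mathbb Z^2$. It acts on the $2^j\times2^j$ array $B$ of the components of $w\in\mathbb R^p$ in $s$ by $F*\mathscr U^{j'-j}B$ if $j\le j'$ and by $\mathscr D^{j-j'}(F*B)$ if $j>j'$. Here $(F*B)_k=\sum_iF_{k-i}B_i$, $(\mathscr UB)_{2k}=B_k$, all other entries of $\mathscr UB$ are $0$, and $(\mathscr DB)_k=B_{2k}$. A filter bank (one filter for every ordered pair of subbands) defines a linear operator on $\mathbb R^p$: the component of the result in $s'$ is the sum over $s$ of these contributions. The kernel filters are $$\widetilde{\mathbf K}_d=\int\!\!\int K(x-x'-2^{-\max(j,j')}d)\,\psi^{(t')}_{j',0}(x')\,\psi^{(t)}_{j,0}(x)\,dx\,dx'.$$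 Let $\tau=2\xi+1$ with $\xi\in\mathbb N$. For a family $\zeta$ of $\tau\times\tau$ central parts, $\mathbf K_\zeta$ is the operator whose filters have the entries $\zeta$ for $\|d\|_\infty\le\xi$ and those of the kernel filters elsewhere; $\Lambda_\zeta$ is the operator whose filters have the entries $\zeta$ for $\|d\|_\infty\le\xi$ and $0$ elsewhere. For $\gamma\ge0$ let $S_\gamma(x)=\operatorname{sign}(x)\max(|x|-\gamma,0)$, and for $\gamma<0$ let $S_\gamma(x)=x-\gamma$ if $x\ge0$ and $x+\gamma$ if $x<0$, componentwise. For $\theta=(\gamma_n,\alpha_n,\beta_n,\zeta_n)_{n=1}^N$ and $m\in Y$ let $f^\tau_\theta(m)=w^{(N)}\in\mathbb R^p$, where $w^{(0)}\in\mathbb R^p$ is given and either (filter-based $\Psi$DONet) $$w^{(n)}=S_{\gamma_n}\big(w^{(n-1)}+\alpha_n(WA_{p,q}^*m-\beta_n\mathbf K_{\zeta_n}w^{(n-1)})\big)$$ or (operator-based $\Psi$DONet) $$w^{(n)}=S_{\gamma_n}\big(w^{(n-1)}+\alpha_n(WA_{p,q}^*m-WA_{p,q}^*A_{p,q}W^*w^{(n-1)})+\beta_n\Lambda_{\zeta_n}w^{(n-1)}\big).$$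 For $L,\lambda>0$, an ISTA parameter $\theta_0$ is one with $\gamma_n=\lambda/L$, $\alpha_n=1/L$ for all $n$ and, in the filter-based case, $\beta_n=1$ and $\zeta_n$ the central parts of the kernel filters, in the operator-based case $\beta_n=0$. **Loss.** For a probability measure $\mu$ on $\mathcal B=\{u\in X_p:\|Wu\|_{\ell^1}\le C_{\mathcal B}\}$ and $\nu=N(0,\sigma^2I_q)$ on $Y_q$ (with respect to $\varphi_1,\dots,\varphi_q$), let $$\mathcal L(\theta;\mu,\nu)=\mathbb E_{u\sim\mu,\ \varepsilon\sim\nu}\big[\|f^\tau_\theta(A_{p,q}u+\varepsilon)-Wu\|^2_{\ell^2}\big],\qquad u,\varepsilon\text{ independent}.$$ **Proposition.** Fix the wavelet basis, $\{\varphi_j\}$, $J_0<J$, $A$, $K$, the implementation (filter- or operator-based), $w^{(0)}$, $C_{\mathcal B}$, and constants $L,c_0,c_q>0$. There is $a\in(0,1)$ with the following properties. For $\sigma>0$ put $\delta=\sigma^{1/3}$ and $\lambda=c_0\delta$, and call $(q,\xi,N,\Theta,\theta^*)$ admissible for $(\mu,\sigma)$ if $\|(I-\mathbb P_q)A\|\le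 c_q\delta$, $\|A_{p,q}^*A_{p,q}\|\le L$, $N\ge\log_a\delta$, $\Theta$ is a set of parameters that contains an ISTA parameter $\theta_0$ for $L,\lambda$, and $\theta^*\in\Theta$ minimizes $\mathcal L(\cdot\,;\mu,\nu)$ over $\Theta$, where $\nu=N(0,\sigma^2I_q)$. 1. There are constants $\sigma_1>0$ and $c^*>0$ such that for all probability measures $\mu$ on $\mathcal B$, all $0<\sigma\le\min\{\sigma_1,q^{1/2}\}$ and all admissible $(q,\xi,N,\Theta,\theta^*)$, $$\mathcal L(\theta^*;\mu,\nu)\le c^*\delta^2 .$$ 2. Consequently, for every probability measure $\mu$ on $\mathcal B$ and all admissible choices depending on $\sigma$, the random variable $f^\tau_{\theta^*}(A_{p,q}u+\varepsilon)$ converges to $Wu$ in mean: $\mathbb E\,\|f^\tau_{\theta^*}(A_{p,q}u+\varepsilon)-Wu\|_{\ell^2}\to0$ as $\delta\to0$. -/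

import Mathlib

open MeasureTheory ProbabilityTheory Filter Topology
open scoped ENNReal NNReal

noncomputable section

namespace PsiDONet

/-! ### The wavelet system on the unit square -/

/-- The types of two-dimensional wavelets: vertical, horizontal, diagonal, low-pass. -/
inductive WaveletType
  | v | h | d | f

instance : Finite WaveletType := by
  refine Set.finite_univ_iff.1 (Set.Finite.subset
    (Set.toFinite {WaveletType.v, WaveletType.h, WaveletType.d, WaveletType.f}) ?_)
  rintro (_ | _ | _ | _) _ <;> simp

/-- The function `ψ^(t)` on the plane, for a scaling function `φ` and a mother wavelet `ψ`. -/
def generator (φ ψ : ℝ → ℝ) : WaveletType → ℝ × ℝ → ℝ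
  | .v, x => φ x.1 * ψ x.2
  | .h, x => ψ x.1 * φ x.2
  | .d, x => ψ x.1 * ψ x.2
  | .f, x => φ x.1 * φ x.2

/-- The wavelet `ψ_{j,k}^(t)(x) = 2^j ψ^(t)(2^j x - k)`. -/
def wavelet (φ ψ : ℝ → ℝ) (j : ℕ) (t : WaveletType) (k : ℕ × ℕ) (x : ℝ × ℝ) : ℝ :=
  2 ^ j * generator φ ψ t (2 ^ j * x.1 - k.1, 2 ^ j * x.2 - k.2)

/-- A subband: a scale `j ≥ J₀` and a type, where the low-pass type occurs only at the
coarsest scale `J₀`. -/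
structure Subband (J₀ : ℕ) where
  scale : ℕ
  type : WaveletType
  le_scale : J₀ ≤ scale
  low_pass : type = WaveletType.f → scale = J₀

/-- The index of a wavelet: a subband of scale `j` and an offset in `{0, …, 2^j - 1}²`. -/
abbrev WaveletIndex (J₀ : ℕ) : Type :=
  Σ s : Subband J₀, Fin (2 ^ s.scale) × Fin (2 ^ s.scale)

/-- The subbands of scale less than `J`. -/
abbrev FinSubband (J₀ J : ℕ) : Type := {s : Subband J₀ // s.scale < J}

/-- The indices of scale less than `J`; for `J₀ ≤ J` there are `p = 2^(2J)` of them. -/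
abbrev FinIndex (J₀ J : ℕ) : Type := {I : WaveletIndex J₀ // I.1.scale < J}

instance (J₀ J : ℕ) : Finite (FinSubband J₀ J) := by
  refine Finite.of_injective
    (fun s : FinSubband J₀ J => ((⟨s.1.scale, s.2⟩ : Fin J), s.1.type)) ?_
  rintro ⟨⟨j, t, h1, h2⟩, h3⟩ ⟨⟨j', t', h1', h2'⟩, h3'⟩ h
  simp only [Prod.mk.injEq, Fin.mk.injEq] at h
  obtain ⟨rfl, rfl⟩ := h
  rfl

instance (J₀ J : ℕ) : Finite (FinIndex J₀ J) := by
  refine Finite.of_injective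
    (β := Σ s : FinSubband J₀ J, Fin (2 ^ s.1.scale) × Fin (2 ^ s.1.scale))
    (fun I => ⟨⟨I.1.1, I.2⟩, I.1.2⟩) ?_
  rintro ⟨⟨s, k⟩, h⟩ ⟨⟨s', k'⟩, h'⟩ e
  simp only [Sigma.mk.injEq, Subtype.mk.injEq] at e
  obtain ⟨rfl, e⟩ := e
  obtain rfl := eq_of_heq e
  rfl

instance (J₀ J : ℕ) : Fintype (FinSubband J₀ J) := Fintype.ofFinite _

instance (J₀ J : ℕ) : Fintype (FinIndex J₀ J) := Fintype.ofFinite _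

/-- The square `[0,1]²`. -/
def unitSquare : Set (ℝ × ℝ) := Set.Icc 0 1 ×ˢ Set.Icc 0 1

/-- The Hilbert space `X = L²([0,1]²)` of images, with its Borel sigma-algebra. -/
abbrev ImageSpace : Type := Lp ℝ 2 (volume.restrict unitSquare)

instance : MeasurableSpace ImageSpace := borel _

instance : BorelSpace ImageSpace := ⟨rfl⟩

/-- `b` is the orthonormal wavelet basis of `L²([0,1]²)` with coarsest scale `J₀` that is
generated by the functions `φ`, `ψ`, both supported in `[0,1]`. -/
structure IsWaveletBasis (φ ψ : ℝ → ℝ) {J₀ : ℕ}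
    (b : HilbertBasis (WaveletIndex J₀) ℝ ImageSpace) : Prop where
  support_scaling : Function.support φ ⊆ Set.Icc 0 1
  support_mother : Function.support ψ ⊆ Set.Icc 0 1
  coe_eq : ∀ I : WaveletIndex J₀, (b I : ℝ × ℝ → ℝ) =ᵐ[volume.restrict unitSquare]
    wavelet φ ψ I.1.scale I.1.type (I.2.1, I.2.2)

/-! ### The forward operator and its discretization -/

/-- `A* A` is a convolutional operator with kernel `K(x, x') = K(x - x')`: its matrix in the
wavelet basis is given by (absolutely convergent) integrals against `K(x - x')`. -/
def IsConvolutional {Y : Type*} [NormedAddCommGroup Y] [InnerProductSpace ℝ Y] [CompleteSpace Y]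
    (φ ψ : ℝ → ℝ) {J₀ : ℕ} (b : HilbertBasis (WaveletIndex J₀) ℝ ImageSpace)
    (A : ImageSpace →L[ℝ] Y) (K : ℝ × ℝ → ℝ) : Prop :=
  ∀ I I' : WaveletIndex J₀,
    Integrable (fun z : (ℝ × ℝ) × (ℝ × ℝ) => K (z.1 - z.2) *
      wavelet φ ψ I.1.scale I.1.type (I.2.1, I.2.2) z.1 *
      wavelet φ ψ I'.1.scale I'.1.type (I'.2.1, I'.2.2) z.2) ∧
    inner ℝ (ContinuousLinearMap.adjoint A (A (b I))) (b I') =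
      ∫ x : ℝ × ℝ, ∫ x' : ℝ × ℝ, K (x - x') *
        wavelet φ ψ I.1.scale I.1.type (I.2.1, I.2.2) x *
        wavelet φ ψ I'.1.scale I'.1.type (I'.2.1, I'.2.2) x'

/-- For a finite orthonormal family `v`, the orthogonal projection onto its span. -/
def projOn {ι E : Type*} [Fintype ι] [NormedAddCommGroup E] [InnerProductSpace ℝ E]
    (v : ι → E) : E →L[ℝ] E :=
  ∑ i, (innerSL ℝ (v i)).smulRight (v i)

variable {Y : Type*} [NormedAddCommGroup Y] [InnerProductSpace ℝ Y]
  {J₀ : ℕ} (b : HilbertBasis (WaveletIndex J₀) ℝ ImageSpace) (e : HilbertBasis ℕ ℝ Y)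

/-- The projection `P_q` of `Y` onto the span `Y_q` of the first `q` basis vectors. -/
def projY (q : ℕ) : Y →L[ℝ] Y := projOn fun j : Fin q => e j

/-- The projection of `X` onto the span `X_p` of the wavelets of scale less than `J`. -/
def projX (J : ℕ) : ImageSpace →L[ℝ] ImageSpace := projOn fun I : FinIndex J₀ J => b I

/-- The discretized operator `A_{p,q}`. -/
def discretize (A : ImageSpace →L[ℝ] Y) (J q : ℕ) : ImageSpace →L[ℝ] Y :=
  projY e q ∘L A ∘L projX b J

/-- The set of all `u ∈ X_p` with `W u ∈ ℓ¹` and `‖W u‖_{ℓ¹} ≤ C`. -/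
def priorBall (J : ℕ) (C : ℝ) : Set ImageSpace :=
  {u | u ∈ Submodule.span ℝ (Set.range fun I : FinIndex J₀ J => b I) ∧
    (Summable fun I => |b.repr u I|) ∧ ∑' I, |b.repr u I| ≤ C}

/-- The Gaussian distribution `N(0, σ² I_q)` on `Y_q`, in the coordinates of the basis of `Y`. -/
def gaussianNoise [MeasurableSpace Y] (q : ℕ) (σ : ℝ) : Measure Y :=
  (Measure.pi fun _ : Fin q => gaussianReal 0 (σ ^ 2).toNNReal).map
    fun x => ∑ j : Fin q, x j • e j

/-! ### Convolutions, upsampling, downsampling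

A `c × c` array is represented by a function of two natural numbers, of which only the entries
with indices less than `c` matter; a filter is a function of two integers. -/

/-- The discrete convolution of a filter with a `c × c` array. -/
def conv (c : ℕ) (F : ℤ → ℤ → ℝ) (B : ℕ → ℕ → ℝ) (k l : ℕ) : ℝ :=
  ∑ i ∈ Finset.range c, ∑ j ∈ Finset.range c, F (k - i) (l - j) * B i j

/-- Upsampling, from `c × c` arrays to `2c × 2c` arrays. -/
def upsample (B : ℕ → ℕ → ℝ) (k l : ℕ) : ℝ :=
  if Even k ∧ Even l then B (k / 2) (l / 2) else 0

/-- Downsampling, from `2c × 2c` arrays to `c × c` arrays. -/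
def downsample (B : ℕ → ℕ → ℝ) (k l : ℕ) : ℝ := B (2 * k) (2 * l)

/-- The operation of a filter from a subband of scale `j` to a subband of scale `j'`; the
convolution takes place at the finer of the two scales. -/
def block (j j' : ℕ) (F : ℤ → ℤ → ℝ) (B : ℕ → ℕ → ℝ) : ℕ → ℕ → ℝ :=
  if j ≤ j' then conv (2 ^ j') F (upsample^[j' - j] B)
  else downsample^[j - j'] (conv (2 ^ j) F B)

/-- The components of `w` in the subband `s`, reshaped to a `2^j × 2^j` array. -/
def reshape {J : ℕ} (w : FinIndex J₀ J → ℝ) (s : FinSubband J₀ J) (k l : ℕ) : ℝ :=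
  if h : k < 2 ^ s.1.scale ∧ l < 2 ^ s.1.scale then
    w ⟨⟨s.1, ⟨k, h.1⟩, ⟨l, h.2⟩⟩, s.2⟩
  else 0

/-- A filter `F s s'` for each pair of subbands, from `s` to `s'`. -/
abbrev FilterBank (J₀ J : ℕ) : Type := FinSubband J₀ J → FinSubband J₀ J → ℤ → ℤ → ℝ

/-- The linear operator on `ℝ^p` that is composed of the blocks of a filter bank. -/
def applyFilters {J : ℕ} (F : FilterBank J₀ J) (w : FinIndex J₀ J → ℝ) (I : FinIndex J₀ J) : ℝ :=
  ∑ s : FinSubband J₀ J,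
    block s.1.scale I.1.1.scale (F s ⟨I.1.1, I.2⟩) (reshape w s) I.1.2.1 I.1.2.2

/-- The filters of the convolutional operator with kernel `K`. -/
def kernelFilter (φ ψ : ℝ → ℝ) (K : ℝ × ℝ → ℝ) (J₀ J : ℕ) : FilterBank J₀ J :=
  fun s s' d₁ d₂ => ∫ x : ℝ × ℝ, ∫ x' : ℝ × ℝ,
    K (x - x' - ((d₁ : ℝ) / 2 ^ max s.1.scale s'.1.scale,
      (d₂ : ℝ) / 2 ^ max s.1.scale s'.1.scale)) *
    wavelet φ ψ s'.1.scale s'.1.type (0, 0) x' * wavelet φ ψ s.1.scale s.1.type (0, 0) x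

/-- The central parts of all filters: `τ × τ` matrices with `τ = 2ξ + 1`. -/
abbrev Centers (J₀ J ξ : ℕ) : Type :=
  FinSubband J₀ J → FinSubband J₀ J → Matrix (Fin (2 * ξ + 1)) (Fin (2 * ξ + 1)) ℝ

/-- The entry at position `r` of a `τ × τ` matrix belongs to the position `r - (ξ, ξ)` of the
filter. This is the central part of a filter bank. -/
def center {J : ℕ} (ξ : ℕ) (F : FilterBank J₀ J) : Centers J₀ J ξ :=
  fun s s' => Matrix.of fun r c => F s s' (((r : ℕ) : ℤ) - ξ) (((c : ℕ) : ℤ) - ξ)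

/-- The filter bank whose entries with `‖d‖_∞ ≤ ξ` are given by `ζ`, the others by `F`. -/
def replaceCenter {J ξ : ℕ} (F : FilterBank J₀ J) (ζ : Centers J₀ J ξ) : FilterBank J₀ J :=
  fun s s' d₁ d₂ =>
    if h : |d₁| ≤ ξ ∧ |d₂| ≤ ξ then
      ζ s s' ⟨(d₁ + ξ).toNat, by have := abs_le.1 h.1; omega⟩
        ⟨(d₂ + ξ).toNat, by have := abs_le.1 h.2; omega⟩
    else F s s' d₁ d₂

/-! ### The network -/

/-- Soft thresholding. For a negative threshold `γ` it is the reflection in the diagonal of the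
curve with threshold `-γ`. -/
def softThreshold (γ x : ℝ) : ℝ :=
  if 0 ≤ γ then
    if x < -γ then x + γ else if |x| ≤ γ then 0 else x - γ
  else
    if 0 ≤ x then x - γ else x + γ

/-- The learnable parameters `γ, α, β, ζ` of a layer. -/
structure LayerParam (J₀ J ξ : ℕ) where
  threshold : ℝ
  step : ℝ
  weight : ℝ
  centers : Centers J₀ J ξ

/-- The two implementations of the network. -/
inductive Implementation
  | filterBased
  | operatorBased

section Network

variable [CompleteSpace Y] (φ ψ : ℝ → ℝ) (K : ℝ × ℝ → ℝ) (A : ImageSpace →L[ℝ] Y) {J : ℕ} (q : ℕ)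

/-- The bias vector `W A_{p,q}* m`. -/
def bias (m : Y) (I : FinIndex J₀ J) : ℝ :=
  b.repr (ContinuousLinearMap.adjoint (discretize b e A J q) m) I

/-- The matrix `W A_{p,q}* A_{p,q} W*`, as an operator on `ℝ^p`. -/
def normalOp (w : FinIndex J₀ J → ℝ) : FinIndex J₀ J → ℝ :=
  bias b e A q (discretize b e A J q (∑ I, w I • b I))

/-- A layer of the network, for the measurements `m`.
Filter-based: `S_γ(w + α (W A_{p,q}* m - β K_ζ w))`, where the filters of `K_ζ` have the learned
center `ζ` and coincide with those of the kernel `K` outside.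
Operator-based: `S_γ(w + α (W A_{p,q}* m - W A_{p,q}* A_{p,q} W* w) + β Λ_ζ w)`, where the
filters of `Λ_ζ` have the learned center `ζ` and vanish outside. -/
def layer {ξ : ℕ} (m : Y) (w : FinIndex J₀ J → ℝ) :
    Implementation → LayerParam J₀ J ξ → FinIndex J₀ J → ℝ
  | .filterBased, θ => fun I => softThreshold θ.threshold
      (w I + θ.step * (bias b e A q m I - θ.weight *
        applyFilters (replaceCenter (kernelFilter φ ψ K J₀ J) θ.centers) w I))
  | .operatorBased, θ => fun I => softThreshold θ.threshold
      (w I + θ.step * (bias b e A q m I - normalOp b e A q w I) + θ.weight *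
        applyFilters (replaceCenter 0 θ.centers) w I)

/-- The vector in `ℝ^p` computed by `N` layers with initial value `w₀`. -/
def iterateLayers {ξ : ℕ} (impl : Implementation) (w₀ : FinIndex J₀ J → ℝ) (m : Y) :
    (N : ℕ) → (Fin N → LayerParam J₀ J ξ) → FinIndex J₀ J → ℝ
  | 0, _ => w₀
  | N + 1, θ => layer b e φ ψ K A q m
      (iterateLayers impl w₀ m N fun n => θ n.castSucc) impl (θ (Fin.last N))

open scoped Classical in
/-- Extension by zero, from `ℝ^p` to `ℓ²`. -/
def extendZero (w : FinIndex J₀ J → ℝ) : lp (fun _ : WaveletIndex J₀ => ℝ) 2 :=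
  ∑ I : FinIndex J₀ J, lp.single 2 (I : WaveletIndex J₀) (w I)

/-- The network `f_θ^τ` with `N` layers, with values in `ℓ²`. -/
def network {ξ N : ℕ} (impl : Implementation) (w₀ : FinIndex J₀ J → ℝ)
    (θ : Fin N → LayerParam J₀ J ξ) (m : Y) : lp (fun _ : WaveletIndex J₀ => ℝ) 2 :=
  extendZero (iterateLayers b e φ ψ K A q impl w₀ m N θ)

/-- The reconstruction error `f_θ^τ(A_{p,q} u + ε) - W u`. -/
def recError {ξ N : ℕ} (impl : Implementation) (w₀ : FinIndex J₀ J → ℝ)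
    (θ : Fin N → LayerParam J₀ J ξ) (u : ImageSpace) (ε : Y) :
    lp (fun _ : WaveletIndex J₀ => ℝ) 2 :=
  network b e φ ψ K A q impl w₀ θ (discretize b e A J q u + ε) - b.repr u

/-- The expected squared loss, for independent `u ∼ μ` and `ε ∼ N(0, σ² I_q)`. -/
def loss [MeasurableSpace Y] {ξ N : ℕ} (impl : Implementation) (w₀ : FinIndex J₀ J → ℝ)
    (μ : Measure ImageSpace) (σ : ℝ) (θ : Fin N → LayerParam J₀ J ξ) : ℝ≥0∞ :=
  ∫⁻ z, ‖recError b e φ ψ K A q impl w₀ θ z.1 z.2‖ₑ ^ 2 ∂(μ.prod (gaussianNoise e q σ))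

end Network

/-- `θ` is a parameter `θ₀` for which the network performs (modified) iterative soft thresholding
with step `1 / L` and regularization parameter `lam`. -/
def IsISTAParam (φ ψ : ℝ → ℝ) (K : ℝ × ℝ → ℝ) {J₀ J ξ N : ℕ} (L lam : ℝ) :
    Implementation → (Fin N → LayerParam J₀ J ξ) → Prop
  | .filterBased, θ => ∀ n, θ n = ⟨lam / L, 1 / L, 1, center ξ (kernelFilter φ ψ K J₀ J)⟩
  | .operatorBased, θ => ∀ n, (θ n).threshold = lam / L ∧ (θ n).step = 1 / L ∧ (θ n).weight = 0

/-- The choices made at noise level `σ`, with `δ = σ^(1/3)`: the number `q` of measurements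
resolves `A` up to `c_q δ`, the step `1 / L` is admissible, there are `N ≥ log_a δ` layers, the
parameter set `Θ` contains a parameter that reproduces iterative soft thresholding with
regularization parameter `c₀ δ`, and `θ` minimizes the expected loss over `Θ`. -/
structure IsOptimalChoice [CompleteSpace Y] [MeasurableSpace Y] (φ ψ : ℝ → ℝ) (K : ℝ × ℝ → ℝ)
    (A : ImageSpace →L[ℝ] Y) {J : ℕ} (impl : Implementation) (w₀ : FinIndex J₀ J → ℝ)
    (L c₀ cq a : ℝ) (μ : Measure ImageSpace) (σ : ℝ) (q : ℕ) {ξ N : ℕ}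
    (Θ : Set (Fin N → LayerParam J₀ J ξ)) (θ : Fin N → LayerParam J₀ J ξ) : Prop where
  resolution : ‖A - projY e q ∘L A‖ ≤ cq * σ ^ (1 / 3 : ℝ)
  norm_le : ‖ContinuousLinearMap.adjoint (discretize b e A J q) ∘L discretize b e A J q‖ ≤ L
  layers : Real.log (σ ^ (1 / 3 : ℝ)) / Real.log a ≤ N
  ista_mem : ∃ θ₀ ∈ Θ, IsISTAParam φ ψ K L (c₀ * σ ^ (1 / 3 : ℝ)) impl θ₀
  mem : θ ∈ Θ
  minimal : ∀ θ' ∈ Θ, loss b e φ ψ K A q impl w₀ μ σ θ ≤ loss b e φ ψ K A q impl w₀ μ σ θ'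

end PsiDONet

end

/-!
The proof compares the learned network with the iterative soft thresholding network that is
contained in the parameter set, and shows directly that the latter reconstructs `W u` up to an
error of order `δ`; minimizers of the `ℓ¹`-regularized functional are not needed.

Since `A` is injective, it is bounded from below on the finite-dimensional space `X_p`, with
`κ ‖x‖² ≤ ‖A x‖²`. By Pythagoras `A_{p,q}` inherits this bound, up to a loss of
`‖(1 - P_q) A‖² = O(δ²)` (`norm_compression_sq_ge`). Hence a gradient step with step size `1 / L` is
a contraction of `X_p`, uniformly in `q` and in small `δ` (`norm_gradient_step_sq_le`). Soft
thresholding with the threshold `λ / L = O(δ)` moves every coefficient by at most `O(δ)`, so a layer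
contracts the distance to `W u` up to `O(δ)` and the back-projected noise `A_{p,q}* ε`
(`norm_layer_sub_le`); after `N ≥ log_a δ` layers the influence of the initial value is at most of
order `δ` as well (`norm_iterateLayers_sub_le`).

In the filter-based network the kernel filters represent the compression of `A* A` to `X_p`. This
is the translation invariance of the integrals against `K (x - x')`, together with the
identification of the up- and downsampled convolutions with sums over the coarse grids
(`applyFilters_kernelFilter`). That operator differs from `A_{p,q}* A_{p,q}` by
`((1 - P_q) A)* ((1 - P_q) A)`, which is again `O(δ²)` (`norm_normalOp_sub_le`).

The noise has variance at most `σ²` in each direction and is back-projected to a space of the fixed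
dimension `p`, so that `E ‖A_{p,q}* ε‖² ≤ p ‖A‖² σ²` with `σ² = δ⁶ ≤ δ²`
(`lintegral_norm_adjoint_discretize_sq_le`). The bound of the loss follows from the minimality of
the learned parameter, and convergence in mean from `x ≤ δ + x² / δ`.
-/

noncomputable section

namespace PsiDONet

/-! ### Orthogonal projections and the discretized operator -/

section Projection

variable {ι E : Type*} [Fintype ι] [NormedAddCommGroup E] [InnerProductSpace ℝ E]

theorem projOn_apply (v : ι → E) (x : E) : projOn v x = ∑ i, inner ℝ (v i) x • v i := by
  simp [projOn]

theorem inner_projOn_left (v : ι → E) (x y : E) :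
    inner ℝ (projOn v x) y = inner ℝ x (projOn v y) := by
  simp only [projOn_apply, sum_inner, inner_sum, real_inner_smul_left, real_inner_smul_right]
  refine Finset.sum_congr rfl fun i _ => ?_
  rw [real_inner_comm x (v i)]
  ring

theorem projOn_of_mem {v : ι → E} (hv : Orthonormal ℝ v) {x : E}
    (hx : x ∈ Submodule.span ℝ (Set.range v)) : projOn v x = x := by
  classical
  obtain ⟨c, rfl⟩ := (Submodule.mem_span_range_iff_exists_fun ℝ).1 hx
  rw [projOn_apply]
  refine Finset.sum_congr rfl fun i _ => ?_
  rw [hv.inner_right_fintype]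

theorem projOn_mem (v : ι → E) (x : E) : projOn v x ∈ Submodule.span ℝ (Set.range v) := by
  rw [projOn_apply]
  exact Submodule.sum_mem _ fun i _ =>
    Submodule.smul_mem _ _ (Submodule.subset_span (Set.mem_range_self i))

theorem isStarProjection_projOn [CompleteSpace E] {v : ι → E} (hv : Orthonormal ℝ v) :
    IsStarProjection (projOn v) where
  isIdempotentElem := by
    ext x
    exact projOn_of_mem hv (projOn_mem v x)
  isSelfAdjoint := by
    rw [ContinuousLinearMap.isSelfAdjoint_iff_isSymmetric]
    exact fun x y => inner_projOn_left v x y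

end Projection

section StarProjection

variable {X Y : Type*} [NormedAddCommGroup X] [InnerProductSpace ℝ X]
  [NormedAddCommGroup Y] [InnerProductSpace ℝ Y]

/-- An injective operator is bounded from below on the span of a finite family. -/
theorem exists_le_norm_sq_on_span {ι : Type*} [Finite ι] (v : ι → X) {A : X →L[ℝ] Y}
    (hA : Function.Injective A) :
    ∃ κ : ℝ, 0 < κ ∧ ∀ x ∈ Submodule.span ℝ (Set.range v), κ * ‖x‖ ^ 2 ≤ ‖A x‖ ^ 2 := by
  have : FiniteDimensional ℝ (Submodule.span ℝ (Set.range v)) :=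
    FiniteDimensional.span_of_finite ℝ (Set.finite_range v)
  obtain ⟨M, hM, h⟩ := LinearMap.exists_antilipschitzWith
    (A.toLinearMap.domRestrict (Submodule.span ℝ (Set.range v)))
    (LinearMap.ker_eq_bot.2 fun x y hxy => Subtype.ext (hA hxy))
  have hM' : (0 : ℝ) < M := hM
  refine ⟨1 / (M : ℝ) ^ 2, by positivity, fun x hx => ?_⟩
  have h1 : ‖x‖ ≤ M * ‖A x‖ := by
    have := h.le_mul_norm_sub ⟨x, hx⟩ 0
    simpa using this
  rw [one_div_mul_eq_div, div_le_iff₀ (by positivity)]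
  calc ‖x‖ ^ 2 ≤ (M * ‖A x‖) ^ 2 := by gcongr
    _ = _ := by ring

variable [CompleteSpace Y]

theorem _root_.IsStarProjection.apply_apply {P : Y →L[ℝ] Y} (hP : IsStarProjection P) (x : Y) :
    P (P x) = P x :=
  DFunLike.congr_fun hP.isIdempotentElem x

theorem _root_.IsStarProjection.adjoint_eq {P : Y →L[ℝ] Y} (hP : IsStarProjection P) :
    ContinuousLinearMap.adjoint P = P :=
  hP.isSelfAdjoint

theorem _root_.IsStarProjection.inner_apply_left {P : Y →L[ℝ] Y} (hP : IsStarProjection P)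
    (x y : Y) : inner ℝ (P x) y = inner ℝ x (P y) := by
  rw [← ContinuousLinearMap.adjoint_inner_right, hP.adjoint_eq]

theorem _root_.IsStarProjection.norm_apply_sq {P : Y →L[ℝ] Y} (hP : IsStarProjection P) (x : Y) :
    ‖P x‖ ^ 2 = ‖x‖ ^ 2 - ‖x - P x‖ ^ 2 := by
  have h : inner ℝ (P x) x = ‖P x‖ ^ 2 := by
    rw [← hP.apply_apply x, hP.inner_apply_left, hP.apply_apply, real_inner_self_eq_norm_sq]
  rw [@norm_sub_sq_real, real_inner_comm, h]
  ring

theorem _root_.IsStarProjection.norm_apply_le {P : Y →L[ℝ] Y} (hP : IsStarProjection P) (x : Y) :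
    ‖P x‖ ≤ ‖x‖ := by
  have := hP.norm_apply_sq x
  exact abs_le_of_sq_le_sq' (by nlinarith [sq_nonneg ‖x - P x‖]) (norm_nonneg x) |>.2

/-- By Pythagoras, replacing `A` by `Q A` lowers the squared norm of the image by at most
`‖(1 - Q) A‖²`. -/
theorem norm_compression_sq_ge {P : X →L[ℝ] X} {Q : Y →L[ℝ] Y}
    (hQ : IsStarProjection Q) (A : X →L[ℝ] Y) {κ η : ℝ} (hη : ‖A - Q ∘L A‖ ≤ η) {x : X}
    (hPx : P x = x) (hx : κ * ‖x‖ ^ 2 ≤ ‖A x‖ ^ 2) :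
    (κ - η ^ 2) * ‖x‖ ^ 2 ≤ ‖(Q ∘L A ∘L P) x‖ ^ 2 := by
  have h1 : ‖A x - Q (A x)‖ ≤ η * ‖x‖ := (A - Q ∘L A).le_of_opNorm_le hη x
  have h2 : ‖A x - Q (A x)‖ ^ 2 ≤ η ^ 2 * ‖x‖ ^ 2 := by
    rw [← mul_pow]
    gcongr
  simp only [ContinuousLinearMap.comp_apply, hPx]
  rw [hQ.norm_apply_sq]
  linarith

variable [CompleteSpace X]

/-- A gradient step for `½‖B · - m‖²` with the admissible step `1 / L` is a contraction in the
directions in which `B` is bounded from below. -/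
theorem norm_gradient_step_sq_le (B : X →L[ℝ] Y) {L κ : ℝ} (hL : 0 < L)
    (hB : ‖ContinuousLinearMap.adjoint B ∘L B‖ ≤ L) {x : X} (hx : κ * ‖x‖ ^ 2 ≤ ‖B x‖ ^ 2) :
    ‖x - (1 / L) • ContinuousLinearMap.adjoint B (B x)‖ ^ 2 ≤ (1 - κ / L) * ‖x‖ ^ 2 := by
  have h1 : ‖ContinuousLinearMap.adjoint B (B x)‖ ^ 2 ≤ L * ‖B x‖ ^ 2 := by
    have h2 := (ContinuousLinearMap.adjoint B).le_opNorm (B x)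
    rw [LinearIsometryEquiv.norm_map] at h2
    rw [ContinuousLinearMap.norm_adjoint_comp_self] at hB
    calc ‖ContinuousLinearMap.adjoint B (B x)‖ ^ 2 ≤ (‖B‖ * ‖B x‖) ^ 2 := by gcongr
      _ = ‖B‖ * ‖B‖ * ‖B x‖ ^ 2 := by ring
      _ ≤ L * ‖B x‖ ^ 2 := by gcongr
  have h3 : inner ℝ x (ContinuousLinearMap.adjoint B (B x)) = ‖B x‖ ^ 2 := by
    rw [ContinuousLinearMap.adjoint_inner_right, real_inner_self_eq_norm_sq]
  rw [@norm_sub_sq_real, real_inner_smul_right, h3, norm_smul, mul_pow, Real.norm_eq_abs, sq_abs]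
  have h4 : (1 / L) ^ 2 * ‖ContinuousLinearMap.adjoint B (B x)‖ ^ 2 ≤ 1 / L * ‖B x‖ ^ 2 := by
    calc _ ≤ (1 / L) ^ 2 * (L * ‖B x‖ ^ 2) := by gcongr
      _ = 1 / L * ‖B x‖ ^ 2 := by field_simp
  have h5 : κ / L * ‖x‖ ^ 2 ≤ 1 / L * ‖B x‖ ^ 2 := by
    calc _ = 1 / L * (κ * ‖x‖ ^ 2) := by ring
      _ ≤ _ := by gcongr
  linarith

theorem adjoint_compression {P : X →L[ℝ] X} {Q : Y →L[ℝ] Y} (hP : IsStarProjection P)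
    (hQ : IsStarProjection Q) (A : X →L[ℝ] Y) :
    ContinuousLinearMap.adjoint (Q ∘L A ∘L P) = P ∘L ContinuousLinearMap.adjoint A ∘L Q := by
  rw [ContinuousLinearMap.adjoint_comp, ContinuousLinearMap.adjoint_comp, hP.adjoint_eq,
    hQ.adjoint_eq]
  rfl

/-- The discretization of the data space changes the normal operator only to second order. -/
theorem norm_normalOp_sub_le {P : X →L[ℝ] X} {Q : Y →L[ℝ] Y} (hP : IsStarProjection P)
    (hQ : IsStarProjection Q) (A : X →L[ℝ] Y) {η : ℝ} (hη : ‖A - Q ∘L A‖ ≤ η) {x : X}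
    (hPx : P x = x) :
    ‖P (ContinuousLinearMap.adjoint A (A x)) -
      ContinuousLinearMap.adjoint (Q ∘L A ∘L P) ((Q ∘L A ∘L P) x)‖ ≤ η ^ 2 * ‖x‖ := by
  have hη0 : 0 ≤ η := (norm_nonneg _).trans hη
  -- `A* A - A* Q A = ((1 - Q) A)* ((1 - Q) A)`, as `1 - Q` is a projection.
  have h : P (ContinuousLinearMap.adjoint A (A x)) -
      ContinuousLinearMap.adjoint (Q ∘L A ∘L P) ((Q ∘L A ∘L P) x) =
      P (ContinuousLinearMap.adjoint (A - Q ∘L A) ((A - Q ∘L A) x)) := by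
    rw [adjoint_compression hP hQ, map_sub, ContinuousLinearMap.adjoint_comp, hQ.adjoint_eq]
    simp [hPx, hQ.apply_apply]
  rw [h]
  calc _ ≤ ‖ContinuousLinearMap.adjoint (A - Q ∘L A) ((A - Q ∘L A) x)‖ := hP.norm_apply_le _
    _ ≤ η * ‖(A - Q ∘L A) x‖ := by
      refine ContinuousLinearMap.le_of_opNorm_le _ ?_ _
      rwa [LinearIsometryEquiv.norm_map]
    _ ≤ η * (η * ‖x‖) := by
      gcongr
      exact ContinuousLinearMap.le_of_opNorm_le _ hη _
    _ = η ^ 2 * ‖x‖ := by ring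

end StarProjection

/-! ### The filter bank of a convolutional operator -/

theorem upsample_iterate (n : ℕ) (B : ℕ → ℕ → ℝ) (k l : ℕ) :
    upsample^[n] B k l = if 2 ^ n ∣ k ∧ 2 ^ n ∣ l then B (k / 2 ^ n) (l / 2 ^ n) else 0 := by
  have key : ∀ k n : ℕ, 2 ^ (n + 1) ∣ k ↔ 2 ∣ k ∧ 2 ^ n ∣ k / 2 := fun k n => by
    rw [pow_succ']
    refine ⟨fun h => ?_, fun ⟨h1, h2⟩ => ?_⟩
    · have h2 := (Dvd.intro _ rfl).trans h
      exact ⟨h2, (Nat.dvd_div_iff_mul_dvd h2).2 h⟩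
    · exact (Nat.dvd_div_iff_mul_dvd h1).1 h2
  induction n generalizing k l with
  | zero => simp
  | succ n ih =>
    rw [Function.iterate_succ_apply', upsample, ih, Nat.div_div_eq_div_mul, Nat.div_div_eq_div_mul,
      ← pow_succ']
    simp only [even_iff_two_dvd, key]
    split_ifs <;> first | rfl | tauto

theorem downsample_iterate (n : ℕ) (B : ℕ → ℕ → ℝ) (k l : ℕ) :
    downsample^[n] B k l = B (2 ^ n * k) (2 ^ n * l) := by
  induction n generalizing k l with
  | zero => simp
  | succ n ih =>
    rw [Function.iterate_succ_apply', downsample, ih, pow_succ, mul_assoc, mul_assoc]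

theorem sum_range_ite_dvd {M : Type*} [AddCommMonoid M] (c : ℕ) {d : ℕ} (hd : 0 < d) (f : ℕ → M) :
    (∑ i ∈ Finset.range (d * c), if d ∣ i then f i else 0) =
      ∑ i ∈ Finset.range c, f (d * i) := by
  rw [← Finset.sum_filter]
  symm
  refine Finset.sum_nbij' (fun i => d * i) (fun i => i / d) ?_ ?_ ?_ ?_ ?_
  · intro i hi
    simpa [hd] using hi
  · intro i hi
    simp only [Finset.mem_filter, Finset.mem_range] at hi ⊢
    exact Nat.div_lt_of_lt_mul hi.1
  · intro i _
    exact Nat.mul_div_cancel_left i hd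
  · intro i hi
    exact Nat.mul_div_cancel' (Finset.mem_filter.1 hi).2
  · intros
    rfl

/-- Convolution of an upsampled array: only the multiples of `2 ^ n` contribute. -/
theorem conv_upsample_iterate (j n : ℕ) (F : ℤ → ℤ → ℝ) (B : ℕ → ℕ → ℝ) (k l : ℕ) :
    conv (2 ^ (n + j)) F (upsample^[n] B) k l =
      ∑ i₁ ∈ Finset.range (2 ^ j), ∑ i₂ ∈ Finset.range (2 ^ j),
        F (k - (2 ^ n * i₁ : ℕ)) (l - (2 ^ n * i₂ : ℕ)) * B i₁ i₂ := by
  have h2 : 0 < 2 ^ n := by positivity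
  have hd : ∀ i, 2 ^ n * i / 2 ^ n = i := fun i => Nat.mul_div_cancel_left i h2
  simp only [conv, upsample_iterate, ite_and, mul_ite, mul_zero, pow_add]
  have h : ∀ i₁ : ℕ, (∑ i₂ ∈ Finset.range (2 ^ n * 2 ^ j), if 2 ^ n ∣ i₁ then
      (if 2 ^ n ∣ i₂ then F (k - i₁) (l - i₂) * B (i₁ / 2 ^ n) (i₂ / 2 ^ n) else 0) else 0) =
      if 2 ^ n ∣ i₁ then ∑ i₂ ∈ Finset.range (2 ^ j),
        F (k - i₁) (l - (2 ^ n * i₂ : ℕ)) * B (i₁ / 2 ^ n) i₂ else 0 := fun i₁ => by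
    split_ifs
    · rw [sum_range_ite_dvd _ h2 fun i₂ : ℕ => F (k - i₁) (l - i₂) * B (i₁ / 2 ^ n) (i₂ / 2 ^ n)]
      simp only [hd]
    · simp
  simp only [h]
  rw [sum_range_ite_dvd _ h2 fun i₁ : ℕ => ∑ i₂ ∈ Finset.range (2 ^ j),
    F (k - i₁) (l - (2 ^ n * i₂ : ℕ)) * B (i₁ / 2 ^ n) i₂]
  simp only [hd]

/-- A block of the filter bank as a double sum over the grid of its input. One of the truncated
differences `j - j'` and `j' - j` vanishes, which covers down- and upsampling in one formula. -/
theorem block_apply (j j' : ℕ) (F : ℤ → ℤ → ℝ) (B : ℕ → ℕ → ℝ) (k l : ℕ) :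
    block j j' F B k l = ∑ i₁ ∈ Finset.range (2 ^ j), ∑ i₂ ∈ Finset.range (2 ^ j),
      F ((2 ^ (j - j') * k : ℕ) - (2 ^ (j' - j) * i₁ : ℕ))
        ((2 ^ (j - j') * l : ℕ) - (2 ^ (j' - j) * i₂ : ℕ)) * B i₁ i₂ := by
  unfold block
  split_ifs with h
  · obtain ⟨n, rfl⟩ := Nat.exists_eq_add_of_le' h
    rw [Nat.add_sub_cancel, conv_upsample_iterate, Nat.sub_eq_zero_of_le (by omega)]
    simp
  · rw [downsample_iterate, Nat.sub_eq_zero_of_le (by omega : j' ≤ j)]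
    simp [conv]

theorem wavelet_eq_translate (φ ψ : ℝ → ℝ) (j : ℕ) (t : WaveletType) (k : ℕ × ℕ) (x : ℝ × ℝ) :
    wavelet φ ψ j t k x =
      wavelet φ ψ j t (0, 0) (x - ((k.1 : ℝ) / 2 ^ j, (k.2 : ℝ) / 2 ^ j)) := by
  simp only [wavelet, Prod.fst_sub, Prod.snd_sub, Nat.cast_zero, sub_zero, mul_sub]
  rw [mul_div_cancel₀ _ (by positivity), mul_div_cancel₀ _ (by positivity)]

/-- Both integrals are invariant under translations, so that the matrix entries of a
convolutional operator depend on the offsets only through their difference. -/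
theorem integral_kernel_wavelet (φ ψ : ℝ → ℝ) (K : ℝ × ℝ → ℝ) (j j' : ℕ) (t t' : WaveletType)
    (i k : ℕ × ℕ) :
    (∫ x : ℝ × ℝ, ∫ x' : ℝ × ℝ, K (x - x') * wavelet φ ψ j t i x * wavelet φ ψ j' t' k x') =
      ∫ x : ℝ × ℝ, ∫ x' : ℝ × ℝ,
        K (x - x' - ((k.1 : ℝ) / 2 ^ j' - (i.1 : ℝ) / 2 ^ j,
          (k.2 : ℝ) / 2 ^ j' - (i.2 : ℝ) / 2 ^ j)) *
        wavelet φ ψ j' t' (0, 0) x' * wavelet φ ψ j t (0, 0) x := by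
  set p : ℝ × ℝ := ((i.1 : ℝ) / 2 ^ j, (i.2 : ℝ) / 2 ^ j) with hp
  set r : ℝ × ℝ := ((k.1 : ℝ) / 2 ^ j', (k.2 : ℝ) / 2 ^ j') with hr
  have hrp : ((k.1 : ℝ) / 2 ^ j' - (i.1 : ℝ) / 2 ^ j, (k.2 : ℝ) / 2 ^ j' - (i.2 : ℝ) / 2 ^ j) =
    r - p := rfl
  rw [hrp]
  conv_rhs => rw [← integral_sub_right_eq_self (μ := (volume : Measure (ℝ × ℝ))) _ p]
  refine integral_congr_ae (.of_forall fun x => ?_)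
  dsimp only
  conv_rhs => rw [← integral_sub_right_eq_self (μ := (volume : Measure (ℝ × ℝ))) _ r]
  refine integral_congr_ae (.of_forall fun x' => ?_)
  dsimp only
  rw [wavelet_eq_translate φ ψ j t i, wavelet_eq_translate φ ψ j' t' k, ← hp, ← hr,
    show x - p - (x' - r) - (r - p) = x - x' by abel]
  ring

/-- At the position at which the block evaluates it, the kernel filter is the matrix entry of the
convolutional operator for the offsets `i` and `k`. -/
theorem kernelFilter_eq_integral (φ ψ : ℝ → ℝ) (K : ℝ × ℝ → ℝ) {J₀ J : ℕ} (s s' : FinSubband J₀ J)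
    (i k : ℕ × ℕ) :
    kernelFilter φ ψ K J₀ J s s'
        ((2 ^ (s.1.scale - s'.1.scale) * k.1 : ℕ) - (2 ^ (s'.1.scale - s.1.scale) * i.1 : ℕ))
        ((2 ^ (s.1.scale - s'.1.scale) * k.2 : ℕ) - (2 ^ (s'.1.scale - s.1.scale) * i.2 : ℕ)) =
      ∫ x : ℝ × ℝ, ∫ x' : ℝ × ℝ, K (x - x') * wavelet φ ψ s.1.scale s.1.type i x *
        wavelet φ ψ s'.1.scale s'.1.type k x' := by
  have key : ∀ j j' k i : ℕ, (((2 ^ (j - j') * k : ℕ) - (2 ^ (j' - j) * i : ℕ) : ℤ) : ℝ) /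
      2 ^ max j j' = (k : ℝ) / 2 ^ j' - (i : ℝ) / 2 ^ j := by
    intro j j' k i
    rcases le_total j j' with h | h
    · obtain ⟨n, rfl⟩ := Nat.exists_eq_add_of_le' h
      rw [max_eq_right h, Nat.sub_eq_zero_of_le h, Nat.add_sub_cancel]
      push_cast
      rw [pow_add]
      field_simp
    · obtain ⟨n, rfl⟩ := Nat.exists_eq_add_of_le' h
      rw [max_eq_left h, Nat.sub_eq_zero_of_le h, Nat.add_sub_cancel]
      push_cast
      rw [pow_add]
      field_simp
  rw [integral_kernel_wavelet]
  simp only [kernelFilter, key]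

theorem replaceCenter_center {J₀ J : ℕ} (ξ : ℕ) (F : FilterBank J₀ J) :
    replaceCenter F (center ξ F) = F := by
  funext s s' d₁ d₂
  unfold replaceCenter
  split_ifs with h
  · have h1 := abs_le.1 h.1
    have h2 := abs_le.1 h.2
    simp only [center, Matrix.of_apply]
    congr 1 <;> omega
  · rfl

theorem sum_finIndex {J₀ J : ℕ} (G : FinIndex J₀ J → ℝ) :
    ∑ I, G I = ∑ s : FinSubband J₀ J, ∑ i : Fin (2 ^ s.1.scale), ∑ k : Fin (2 ^ s.1.scale),
      G ⟨⟨s.1, i, k⟩, s.2⟩ := by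
  let E : FinIndex J₀ J ≃ Σ s : FinSubband J₀ J, Fin (2 ^ s.1.scale) × Fin (2 ^ s.1.scale) :=
    { toFun := fun I => ⟨⟨I.1.1, I.2⟩, I.1.2⟩
      invFun := fun I => ⟨⟨I.1.1, I.2⟩, I.1.2⟩
      left_inv := fun _ => rfl
      right_inv := fun _ => rfl }
  simp_rw [← Fintype.sum_prod_type', ← E.symm.sum_comp G, Fintype.sum_sigma]
  rfl

/-- The filter bank of the kernel `K` represents the operator `A* A` in the wavelet basis. -/
theorem applyFilters_kernelFilter {Y : Type*} [NormedAddCommGroup Y] [InnerProductSpace ℝ Y]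
    [CompleteSpace Y] {φ ψ : ℝ → ℝ} {J₀ J : ℕ}
    {b : HilbertBasis (WaveletIndex J₀) ℝ ImageSpace} {A : ImageSpace →L[ℝ] Y} {K : ℝ × ℝ → ℝ}
    (hK : IsConvolutional φ ψ b A K) (w : FinIndex J₀ J → ℝ) (I : FinIndex J₀ J) :
    applyFilters (kernelFilter φ ψ K J₀ J) w I =
      inner ℝ (b I) (ContinuousLinearMap.adjoint A (A (∑ I', w I' • b I'))) := by
  rw [real_inner_comm]
  simp only [map_sum, map_smul, sum_inner, real_inner_smul_left, (hK _ _).2]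
  rw [sum_finIndex]
  refine Finset.sum_congr rfl fun s _ => ?_
  rw [block_apply, Finset.sum_range]
  refine Finset.sum_congr rfl fun i _ => ?_
  rw [Finset.sum_range]
  refine Finset.sum_congr rfl fun k _ => ?_
  rw [mul_comm]
  congr 1
  · simp [reshape]
  · exact kernelFilter_eq_integral φ ψ K s ⟨I.1.1, I.2⟩ (i, k) (I.1.2.1, I.1.2.2)

/-! ### The noise -/

theorem lintegral_sum_mul_gaussianReal_sq {q : ℕ} (v : ℝ≥0) (c : Fin q → ℝ) :
    ∫⁻ x, ENNReal.ofReal ((∑ j, c j * x j) ^ 2) ∂(Measure.pi fun _ : Fin q => gaussianReal 0 v) =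
      ENNReal.ofReal (v * ∑ j, c j ^ 2) := by
  have hm : ∀ j, MemLp (fun y : ℝ => c j * y) 2 (gaussianReal 0 v) := fun j =>
    (memLp_id_gaussianReal' 2 (by simp)).const_mul (c j)
  have hp : ∀ j, MemLp (fun x : Fin q → ℝ => c j * x j) 2
      (Measure.pi fun _ : Fin q => gaussianReal 0 v) := fun j =>
    (hm j).comp_measurePreserving (measurePreserving_eval _ j)
  have hs : MemLp (fun x : Fin q → ℝ => ∑ j, c j * x j) 2
      (Measure.pi fun _ : Fin q => gaussianReal 0 v) := memLp_finsetSum _ fun j _ => hp j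
  have h0 : ∫ x, (∑ j, c j * x j) ∂(Measure.pi fun _ : Fin q => gaussianReal 0 v) = 0 := by
    rw [integral_finsetSum _ fun j _ => (hp j).integrable (by norm_num)]
    refine Finset.sum_eq_zero fun j _ => ?_
    have h := integral_comp_eval (μ := fun _ : Fin q => gaussianReal 0 v) (i := j)
      (f := fun y : ℝ => y) (by fun_prop)
    rw [integral_const_mul, h, integral_id_gaussianReal, mul_zero]
  rw [← ofReal_integral_eq_lintegral_ofReal hs.integrable_sq (.of_forall fun _ => sq_nonneg _)]
  have h1 := variance_of_integral_eq_zero hs.aemeasurable h0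
  have h2 := variance_sum_pi (μ := fun _ : Fin q => gaussianReal 0 v) (X := fun j y => c j * y) hm
  congr 1
  rw [← h1, Finset.mul_sum]
  have h3 : (∑ j, fun x : Fin q → ℝ => c j * x j) = fun x => ∑ j, c j * x j := by
    ext x; simp
  rw [← h3, h2]
  refine Finset.sum_congr rfl fun j _ => ?_
  have h4 : Var[fun y => y; gaussianReal 0 v] = v := variance_id_gaussianReal
  rw [variance_const_mul, h4]
  ring

section

variable {Y : Type*} [NormedAddCommGroup Y] [InnerProductSpace ℝ Y] [MeasurableSpace Y]
  [BorelSpace Y] (e : HilbertBasis ℕ ℝ Y)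

theorem measurable_sum_smul_basis (q : ℕ) :
    Measurable fun x : Fin q → ℝ => ∑ j : Fin q, x j • e j :=
  Continuous.measurable (by fun_prop)

theorem measurable_ofReal_inner_sq (y : Y) :
    Measurable fun ε : Y => ENNReal.ofReal (inner ℝ y ε ^ 2) :=
  (Continuous.measurable (by fun_prop)).ennreal_ofReal

instance (q : ℕ) (σ : ℝ) : IsProbabilityMeasure (gaussianNoise e q σ) :=
  Measure.isProbabilityMeasure_map (measurable_sum_smul_basis e q).aemeasurable

/-- In every direction the noise has variance at most `σ²`. -/
theorem lintegral_inner_gaussianNoise_sq_le (q : ℕ) (σ : ℝ) (y : Y) :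
    ∫⁻ ε, ENNReal.ofReal (inner ℝ y ε ^ 2) ∂(gaussianNoise e q σ) ≤
      ENNReal.ofReal (σ ^ 2 * ‖y‖ ^ 2) := by
  rw [gaussianNoise, lintegral_map (measurable_ofReal_inner_sq y) (measurable_sum_smul_basis e q)]
  have h : ∀ x : Fin q → ℝ, inner ℝ y (∑ j : Fin q, x j • e j) =
      ∑ j : Fin q, inner ℝ y (e j) * x j := fun x => by
    simp [inner_sum, real_inner_smul_right, mul_comm]
  simp only [h]
  rw [lintegral_sum_mul_gaussianReal_sq, Real.coe_toNNReal _ (sq_nonneg σ)]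
  refine ENNReal.ofReal_le_ofReal ?_
  gcongr
  have := (e.orthonormal.comp (fun j : Fin q => (j : ℕ)) Fin.val_injective).sum_inner_products_le
    y (s := Finset.univ)
  simpa [real_inner_comm] using this

end

/-! ### Synthesis of images from wavelet coefficients -/

theorem abs_softThreshold_sub_le {γ : ℝ} (hγ : 0 ≤ γ) (x : ℝ) : |softThreshold γ x - x| ≤ γ := by
  rw [softThreshold, if_pos hγ]
  split_ifs with h1 h2
  · rw [add_sub_cancel_left, abs_of_nonneg hγ]
  · rwa [zero_sub, abs_neg]
  · rw [sub_sub_cancel_left, abs_neg, abs_of_nonneg hγ]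

section Coefficients

variable {J₀ J : ℕ} (b : HilbertBasis (WaveletIndex J₀) ℝ ImageSpace)

/-- The element of `X_p` with the wavelet coefficients `w`, that is `W* w`. -/
def synthesis (w : FinIndex J₀ J → ℝ) : ImageSpace := ∑ I, w I • b I

theorem orthonormal_finIndex : Orthonormal ℝ fun I : FinIndex J₀ J => b I :=
  b.orthonormal.comp _ Subtype.val_injective

theorem synthesis_inner (x : ImageSpace) :
    synthesis b (fun I : FinIndex J₀ J => inner ℝ (b I) x) = projX b J x :=
  (projOn_apply _ x).symm

theorem repr_synthesis (w : FinIndex J₀ J → ℝ) : b.repr (synthesis b w) = extendZero w := by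
  classical
  simp only [synthesis, extendZero, map_sum, map_smul, HilbertBasis.repr_self]
  refine Finset.sum_congr rfl fun I _ => ?_
  rw [← lp.single_smul, smul_eq_mul, mul_one]

theorem synthesis_mem (w : FinIndex J₀ J → ℝ) :
    synthesis b w ∈ Submodule.span ℝ (Set.range fun I : FinIndex J₀ J => b I) :=
  Submodule.sum_mem _ fun I _ =>
    Submodule.smul_mem _ _ (Submodule.subset_span (Set.mem_range_self I))

theorem synthesis_add_mul_sub (w v v' : FinIndex J₀ J → ℝ) (α : ℝ) :
    synthesis b (fun I => w I + α * (v I - v' I)) =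
      synthesis b w + α • (synthesis b v - synthesis b v') := by
  simp only [synthesis, add_smul, mul_smul, sub_smul, Finset.sum_add_distrib,
    Finset.sum_sub_distrib, ← Finset.smul_sum]

theorem norm_synthesis_le {w : FinIndex J₀ J → ℝ} {γ : ℝ} (h : ∀ I, |w I| ≤ γ) :
    ‖synthesis b w‖ ≤ Fintype.card (FinIndex J₀ J) * γ := by
  refine (norm_sum_le _ _).trans ?_
  rw [← nsmul_eq_mul]
  refine Finset.sum_le_card_nsmul _ _ _ fun I _ => ?_
  rw [norm_smul, b.orthonormal.1, mul_one]
  exact h I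

/-- Soft thresholding moves every coefficient by at most the threshold. -/
theorem norm_synthesis_softThreshold_sub_le {γ : ℝ} (hγ : 0 ≤ γ) (w : FinIndex J₀ J → ℝ)
    (u : ImageSpace) :
    ‖synthesis b (fun I => softThreshold γ (w I)) - u‖ ≤
      ‖synthesis b w - u‖ + Fintype.card (FinIndex J₀ J) * γ := by
  have h : synthesis b (fun I => softThreshold γ (w I)) - u =
      (synthesis b w - u) + synthesis b (fun I => softThreshold γ (w I) - w I) := by
    simp only [synthesis, sub_smul, Finset.sum_sub_distrib]
    abel
  rw [h]
  exact (norm_add_le _ _).trans (add_le_add_right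
    (norm_synthesis_le b fun I => abs_softThreshold_sub_le hγ (w I)) _)

theorem norm_le_of_mem_priorBall {C : ℝ} {u : ImageSpace} (hu : u ∈ priorBall b J C) :
    ‖u‖ ≤ C := by
  obtain ⟨hu, hs, hC⟩ := hu
  have h : projX b J u = u := projOn_of_mem (orthonormal_finIndex b) hu
  calc ‖u‖ = ‖∑ I : FinIndex J₀ J, b.repr u I • b I‖ := by
        conv_lhs => rw [← h]
        simp only [projX, projOn_apply, HilbertBasis.repr_apply_apply]
    _ ≤ ∑ I : FinIndex J₀ J, |b.repr u I| := by
        refine (norm_sum_le _ _).trans_eq (Finset.sum_congr rfl fun I _ => ?_)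
        rw [norm_smul, b.orthonormal.1, mul_one, Real.norm_eq_abs]
    _ ≤ ∑' I, |b.repr u I| := by
        rw [← tsum_fintype (L := .unconditional _)]
        exact hs.comp_injective Subtype.val_injective |>.tsum_le_tsum_of_inj _
          Subtype.val_injective (fun _ _ => abs_nonneg _) (fun _ => le_rfl) hs
    _ ≤ C := hC

end Coefficients

/-! ### Layers that perform iterative soft thresholding -/

section Layers

variable {Y : Type*} [NormedAddCommGroup Y] [InnerProductSpace ℝ Y] [CompleteSpace Y]
  {J₀ J : ℕ} (b : HilbertBasis (WaveletIndex J₀) ℝ ImageSpace) (e : HilbertBasis ℕ ℝ Y)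
  {φ ψ : ℝ → ℝ} {K : ℝ × ℝ → ℝ} {A : ImageSpace →L[ℝ] Y} (q : ℕ)

theorem isStarProjection_projX : IsStarProjection (projX b J) :=
  isStarProjection_projOn (orthonormal_finIndex b)

theorem isStarProjection_projY : IsStarProjection (projY e q) :=
  isStarProjection_projOn (e.orthonormal.comp _ Fin.val_injective)

theorem projX_adjoint_discretize (m : Y) :
    projX b J (ContinuousLinearMap.adjoint (discretize b e A J q) m) =
      ContinuousLinearMap.adjoint (discretize b e A J q) m := by
  rw [discretize, adjoint_compression (isStarProjection_projX b) (isStarProjection_projY e q)]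
  exact (isStarProjection_projX b).apply_apply _

theorem synthesis_bias (m : Y) :
    synthesis b (bias b e A (J := J) q m) =
      ContinuousLinearMap.adjoint (discretize b e A J q) m := by
  rw [← projX_adjoint_discretize, ← synthesis_inner]
  congr 1
  funext I
  exact b.repr_apply_apply _ _

theorem norm_discretize_le : ‖discretize b e A J q‖ ≤ ‖A‖ := by
  refine ContinuousLinearMap.opNorm_le_bound _ (norm_nonneg _) fun x => ?_
  calc ‖discretize b e A J q x‖ ≤ ‖A (projX b J x)‖ :=
        (isStarProjection_projY e q).norm_apply_le _
    _ ≤ ‖A‖ * ‖projX b J x‖ := A.le_opNorm _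
    _ ≤ ‖A‖ * ‖x‖ := by
        gcongr
        exact (isStarProjection_projX b).norm_apply_le x

theorem synthesis_applyFilters_kernelFilter (hK : IsConvolutional φ ψ b A K)
    (w : FinIndex J₀ J → ℝ) :
    synthesis b (applyFilters (kernelFilter φ ψ K J₀ J) w) =
      projX b J (ContinuousLinearMap.adjoint A (A (synthesis b w))) := by
  rw [← synthesis_inner]
  congr 1
  funext I
  exact applyFilters_kernelFilter hK w I

variable {q}

/-- In the operator-based network an iterative soft thresholding layer takes an exact gradient
step; in the filter-based network `A_{p,q}* A_{p,q}` is replaced by the restriction of `A* A`, which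
differs from it by at most `η²`. In both cases the error is contracted, up to the noise, the
threshold and this discrepancy. -/
theorem norm_layer_sub_le (hK : IsConvolutional φ ψ b A K) {impl : Implementation}
    {L lam κ η ρ : ℝ} (hL : 0 < L) (hlam : 0 ≤ lam) (hρ0 : 0 ≤ ρ)
    (hκ : ∀ x ∈ Submodule.span ℝ (Set.range fun I : FinIndex J₀ J => b I),
      κ * ‖x‖ ^ 2 ≤ ‖A x‖ ^ 2)
    (hρ : 1 - (κ - η ^ 2) / L ≤ ρ ^ 2)
    (hη : ‖A - projY e q ∘L A‖ ≤ η)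
    (hnorm : ‖ContinuousLinearMap.adjoint (discretize b e A J q) ∘L discretize b e A J q‖ ≤ L)
    {ξ N : ℕ} {θ : Fin N → LayerParam J₀ J ξ} (hθ : IsISTAParam φ ψ K L lam impl θ) (n : Fin N)
    {u : ImageSpace} (hu : u ∈ Submodule.span ℝ (Set.range fun I : FinIndex J₀ J => b I)) (ε : Y)
    (w : FinIndex J₀ J → ℝ) :
    ‖synthesis b (layer b e φ ψ K A q (discretize b e A J q u + ε) w impl (θ n)) - u‖ ≤
      (ρ + η ^ 2 / L) * ‖synthesis b w - u‖ +
        (‖ContinuousLinearMap.adjoint (discretize b e A J q) ε‖ +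
          Fintype.card (FinIndex J₀ J) * lam + η ^ 2 * ‖u‖) / L := by
  have hP : IsStarProjection (projX b J) := isStarProjection_projX b
  have hQ := isStarProjection_projY e q
  have hPx : ∀ x ∈ Submodule.span ℝ (Set.range fun I : FinIndex J₀ J => b I), projX b J x = x :=
    fun x hx => projOn_of_mem (orthonormal_finIndex b) hx
  set B := discretize b e A J q with hB
  set x := synthesis b w - u with hx
  have hxm : x ∈ Submodule.span ℝ (Set.range fun I : FinIndex J₀ J => b I) :=
    Submodule.sub_mem _ (synthesis_mem b w) hu
  have hstep : ‖x - (1 / L) • ContinuousLinearMap.adjoint B (B x)‖ ≤ ρ * ‖x‖ := by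
    refine abs_le_of_sq_le_sq' ?_ (by positivity) |>.2
    refine (norm_gradient_step_sq_le B hL hnorm
      (norm_compression_sq_ge hQ A hη (hPx x hxm) (hκ x hxm))).trans ?_
    rw [mul_pow]
    gcongr
  have hnoise : ‖(1 / L) • ContinuousLinearMap.adjoint B ε‖ =
      ‖ContinuousLinearMap.adjoint B ε‖ / L := by
    rw [norm_smul, Real.norm_of_nonneg (by positivity), one_div_mul_eq_div]
  have hlamL : 0 ≤ lam / L := by positivity
  have hxL : 0 ≤ η ^ 2 / L * ‖x‖ := by positivity
  have huL : 0 ≤ η ^ 2 * ‖u‖ / L := by positivity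
  cases impl with
  | operatorBased =>
    obtain ⟨h1, h2, h3⟩ := hθ n
    simp only [layer, h1, h2, h3, zero_mul, add_zero]
    refine (norm_synthesis_softThreshold_sub_le b hlamL _ u).trans ?_
    have hz : synthesis b (fun I => w I + 1 / L * (bias b e A q (B u + ε) I -
        normalOp b e A q w I)) - u =
        (x - (1 / L) • ContinuousLinearMap.adjoint B (B x)) +
          (1 / L) • ContinuousLinearMap.adjoint B ε := by
      have h5 : synthesis b (normalOp b e A q w) =
          ContinuousLinearMap.adjoint B (B (synthesis b w)) := synthesis_bias b e q _
      rw [synthesis_add_mul_sub, h5, synthesis_bias, ← hB, hx]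
      simp only [map_add, map_sub]
      module
    rw [hz]
    refine (add_le_add_left (norm_add_le _ _) _).trans ?_
    rw [hnoise]
    calc _ ≤ ρ * ‖x‖ + ‖ContinuousLinearMap.adjoint B ε‖ / L +
          Fintype.card (FinIndex J₀ J) * (lam / L) := by gcongr
      _ ≤ ρ * ‖x‖ + ‖ContinuousLinearMap.adjoint B ε‖ / L +
          Fintype.card (FinIndex J₀ J) * (lam / L) + η ^ 2 / L * ‖x‖ + η ^ 2 * ‖u‖ / L := by
        linarith
      _ = _ := by ring
  | filterBased =>
    rw [hθ n]
    simp only [layer, one_mul, replaceCenter_center]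
    refine (norm_synthesis_softThreshold_sub_le b hlamL _ u).trans ?_
    -- `v` is the discrepancy of the kernel filters from the normal operator `A_{p,q}* A_{p,q}`.
    set v := projX b J (ContinuousLinearMap.adjoint A (A (synthesis b w))) -
      ContinuousLinearMap.adjoint B (B (synthesis b w)) with hv
    have hvn : ‖(1 / L) • v‖ ≤ η ^ 2 / L * (‖x‖ + ‖u‖) := by
      have h1 := norm_normalOp_sub_le hP hQ A hη (hPx _ (synthesis_mem b w))
      have h2 : ‖synthesis b w‖ ≤ ‖x‖ + ‖u‖ := by
        simpa [hx] using norm_add_le x u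
      rw [norm_smul, Real.norm_of_nonneg (by positivity)]
      calc 1 / L * ‖v‖ ≤ 1 / L * (η ^ 2 * (‖x‖ + ‖u‖)) := by
            gcongr
            exact h1.trans (by gcongr)
        _ = _ := by ring
    have hz : synthesis b (fun I => w I + 1 / L * (bias b e A q (B u + ε) I -
        applyFilters (kernelFilter φ ψ K J₀ J) w I)) - u =
        (x - (1 / L) • ContinuousLinearMap.adjoint B (B x)) +
          (1 / L) • ContinuousLinearMap.adjoint B ε - (1 / L) • v := by
      rw [synthesis_add_mul_sub, synthesis_applyFilters_kernelFilter b hK, synthesis_bias, ← hB,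
        hv, hx]
      simp only [map_add, map_sub]
      module
    rw [hz]
    refine (add_le_add_left ((norm_sub_le _ _).trans (add_le_add_left (norm_add_le _ _) _))
      _).trans ?_
    rw [hnoise]
    calc _ ≤ ρ * ‖x‖ + ‖ContinuousLinearMap.adjoint B ε‖ / L + η ^ 2 / L * (‖x‖ + ‖u‖) +
          Fintype.card (FinIndex J₀ J) * (lam / L) := by gcongr
      _ = _ := by ring

/-- Iterating the bound for one layer sums a geometric series with ratio `a`. -/
theorem norm_iterateLayers_sub_le (hK : IsConvolutional φ ψ b A K) {impl : Implementation}
    {L lam κ η ρ a : ℝ} (hL : 0 < L) (hlam : 0 ≤ lam) (hρ0 : 0 ≤ ρ)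
    (hκ : ∀ x ∈ Submodule.span ℝ (Set.range fun I : FinIndex J₀ J => b I),
      κ * ‖x‖ ^ 2 ≤ ‖A x‖ ^ 2)
    (hρ : 1 - (κ - η ^ 2) / L ≤ ρ ^ 2) (ha : ρ + η ^ 2 / L ≤ a) (ha1 : a < 1)
    (hη : ‖A - projY e q ∘L A‖ ≤ η)
    (hnorm : ‖ContinuousLinearMap.adjoint (discretize b e A J q) ∘L discretize b e A J q‖ ≤ L)
    {ξ N : ℕ} {θ : Fin N → LayerParam J₀ J ξ} (hθ : IsISTAParam φ ψ K L lam impl θ)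
    {u : ImageSpace} (hu : u ∈ Submodule.span ℝ (Set.range fun I : FinIndex J₀ J => b I)) (ε : Y)
    (w₀ : FinIndex J₀ J → ℝ) :
    ‖synthesis b (iterateLayers b e φ ψ K A q impl w₀ (discretize b e A J q u + ε) N θ) - u‖ ≤
      a ^ N * ‖synthesis b w₀ - u‖ +
        (‖ContinuousLinearMap.adjoint (discretize b e A J q) ε‖ +
          Fintype.card (FinIndex J₀ J) * lam + η ^ 2 * ‖u‖) / L / (1 - a) := by
  have ha0 : 0 ≤ a := le_trans (by positivity) ha
  set β := (‖ContinuousLinearMap.adjoint (discretize b e A J q) ε‖ +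
    Fintype.card (FinIndex J₀ J) * lam + η ^ 2 * ‖u‖) / L with hβ
  have h1a : 0 < 1 - a := by linarith
  have hβ0 : 0 ≤ β / (1 - a) := by positivity
  induction N with
  | zero => simpa [iterateLayers] using hβ0
  | succ N ih =>
    have hθ' : IsISTAParam φ ψ K L lam impl fun n : Fin N => θ n.castSucc := by
      cases impl <;> exact fun n => hθ n.castSucc
    refine (norm_layer_sub_le b e hK hL hlam hρ0 hκ hρ hη hnorm hθ _ hu ε _).trans ?_
    rw [← hβ]
    calc _ ≤ a * (a ^ N * ‖synthesis b w₀ - u‖ + β / (1 - a)) + β := by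
          gcongr
          exact ih hθ'
      _ = a ^ (N + 1) * ‖synthesis b w₀ - u‖ + β / (1 - a) := by
          field_simp
          ring

theorem norm_recError {impl : Implementation} {ξ N : ℕ} (w₀ : FinIndex J₀ J → ℝ)
    (θ : Fin N → LayerParam J₀ J ξ) (u : ImageSpace) (ε : Y) :
    ‖recError b e φ ψ K A q impl w₀ θ u ε‖ =
      ‖synthesis b (iterateLayers b e φ ψ K A q impl w₀
        (discretize b e A J q u + ε) N θ) - u‖ := by
  rw [recError, network, ← repr_synthesis, ← map_sub, LinearIsometryEquiv.norm_map]

end Layers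

/-! ### The expected loss -/

section Loss

variable {Y : Type*} [NormedAddCommGroup Y] [InnerProductSpace ℝ Y] [CompleteSpace Y]
  [MeasurableSpace Y] [BorelSpace Y]
  {J₀ J : ℕ} (b : HilbertBasis (WaveletIndex J₀) ℝ ImageSpace) (e : HilbertBasis ℕ ℝ Y)
  {φ ψ : ℝ → ℝ} {K : ℝ × ℝ → ℝ} {A : ImageSpace →L[ℝ] Y} {q : ℕ}

/-- Back-projection to the finite-dimensional space `X_p` keeps the noise bounded uniformly in the
number `q` of measurements. -/
theorem lintegral_norm_adjoint_discretize_sq_le (σ : ℝ) :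
    ∫⁻ ε, ENNReal.ofReal (‖ContinuousLinearMap.adjoint (discretize b e A J q) ε‖ ^ 2)
        ∂(gaussianNoise e q σ) ≤
      ENNReal.ofReal (Fintype.card (FinIndex J₀ J) * (σ ^ 2 * ‖A‖ ^ 2)) := by
  have h : ∀ ε, ‖ContinuousLinearMap.adjoint (discretize b e A J q) ε‖ ^ 2 =
      ∑ I : FinIndex J₀ J, inner ℝ (discretize b e A J q (b I)) ε ^ 2 := fun ε => by
    rw [← real_inner_self_eq_norm_sq]
    conv_lhs => rw [← projX_adjoint_discretize, projX, inner_projOn_left, projOn_apply]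
    rw [inner_sum, ← projX, projX_adjoint_discretize]
    refine Finset.sum_congr rfl fun I _ => ?_
    rw [real_inner_smul_right, real_inner_comm (b I : ImageSpace),
      ContinuousLinearMap.adjoint_inner_right, sq]
  simp only [h, ENNReal.ofReal_sum_of_nonneg fun _ _ => sq_nonneg _]
  rw [lintegral_finsetSum _ fun I _ => measurable_ofReal_inner_sq _]
  have hle : ∀ I : FinIndex J₀ J, ∫⁻ ε, ENNReal.ofReal
      (inner ℝ (discretize b e A J q (b I)) ε ^ 2) ∂(gaussianNoise e q σ) ≤
      ENNReal.ofReal (σ ^ 2 * ‖A‖ ^ 2) := fun I => by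
    refine (lintegral_inner_gaussianNoise_sq_le e q σ _).trans (ENNReal.ofReal_le_ofReal ?_)
    gcongr
    refine ((discretize b e A J q).le_opNorm _).trans ?_
    rw [b.orthonormal.1, mul_one]
    exact norm_discretize_le b e q
  refine (Finset.sum_le_card_nsmul _ _ _ fun I _ => hle I).trans_eq ?_
  rw [nsmul_eq_mul, ENNReal.ofReal_mul (p := (Fintype.card _ : ℝ)) (by positivity),
    ENNReal.ofReal_natCast]
  rfl

/-- A pointwise bound of the error in terms of the back-projected noise bounds the expected loss. -/
theorem loss_le_of_norm_recError_le {impl : Implementation} {w₀ : FinIndex J₀ J → ℝ} {C : ℝ}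
    {μ : Measure ImageSpace} [IsProbabilityMeasure μ] (hμ : ∀ᵐ u ∂μ, u ∈ priorBall b J C)
    {σ c₁ c₂ : ℝ} {ξ N : ℕ} {θ : Fin N → LayerParam J₀ J ξ}
    (h : ∀ u ∈ priorBall b J C, ∀ ε, ‖recError b e φ ψ K A q impl w₀ θ u ε‖ ≤
      c₁ + c₂ * ‖ContinuousLinearMap.adjoint (discretize b e A J q) ε‖) :
    loss b e φ ψ K A q impl w₀ μ σ θ ≤ ENNReal.ofReal (2 * c₁ ^ 2 +
      2 * c₂ ^ 2 * (Fintype.card (FinIndex J₀ J) * (σ ^ 2 * ‖A‖ ^ 2))) := by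
  have hm : Measurable fun ε => ENNReal.ofReal
      (‖ContinuousLinearMap.adjoint (discretize b e A J q) ε‖ ^ 2) :=
    (Continuous.measurable (by fun_prop)).ennreal_ofReal
  have hae : ∀ᵐ z ∂(μ.prod (gaussianNoise e q σ)),
      ‖recError b e φ ψ K A q impl w₀ θ z.1 z.2‖ₑ ^ 2 ≤ ENNReal.ofReal (2 * c₁ ^ 2) +
        ENNReal.ofReal (2 * c₂ ^ 2) * ENNReal.ofReal
          (‖ContinuousLinearMap.adjoint (discretize b e A J q) z.2‖ ^ 2) := by
    filter_upwards [Measure.quasiMeasurePreserving_fst.ae hμ] with z hz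
    rw [← ENNReal.ofReal_mul (by positivity), ← ENNReal.ofReal_add (by positivity) (by positivity),
      ← ofReal_norm, ← ENNReal.ofReal_pow (norm_nonneg _)]
    refine ENNReal.ofReal_le_ofReal ?_
    set t := ‖ContinuousLinearMap.adjoint (discretize b e A J q) z.2‖
    calc _ ≤ (c₁ + c₂ * t) ^ 2 := by
          gcongr
          exact h _ hz _
      _ ≤ 2 * c₁ ^ 2 + 2 * c₂ ^ 2 * t ^ 2 := by nlinarith [sq_nonneg (c₁ - c₂ * t)]
  refine (lintegral_mono_ae hae).trans ?_
  rw [lintegral_add_left measurable_const, lintegral_const, measure_univ, mul_one,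
    lintegral_const_mul' _ _ ENNReal.ofReal_ne_top,
    measurePreserving_snd.lintegral_comp hm,
    ENNReal.ofReal_add (by positivity) (by positivity),
    ENNReal.ofReal_mul (p := 2 * c₂ ^ 2) (by positivity)]
  gcongr
  exact lintegral_norm_adjoint_discretize_sq_le b e σ

/-- A contraction factor `a < 1` that is valid for all small `δ`. -/
theorem exists_contraction_factor {κ L : ℝ} (hκ : 0 < κ) (hL : 0 < L) {cq : ℝ} (hcq : 0 < cq) :
    ∃ ρ a δ₁ : ℝ, 0 ≤ ρ ∧ 0 < a ∧ a < 1 ∧ 0 < δ₁ ∧ δ₁ ≤ 1 ∧ ∀ δ, 0 < δ → δ ≤ δ₁ →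
      1 - (κ - (cq * δ) ^ 2) / L ≤ ρ ^ 2 ∧ ρ + (cq * δ) ^ 2 / L ≤ a := by
  have hκL : 0 < κ / (2 * L) := by positivity
  -- The maximum matters only for `κ > 2 L`, where `‖A_{p,q}* A_{p,q}‖ ≤ L` fails for small `δ`.
  set ρ := √(max 0 (1 - κ / (2 * L))) with hρ
  have hρ0 : 0 ≤ ρ := Real.sqrt_nonneg _
  have hρ2 : ρ ^ 2 = max 0 (1 - κ / (2 * L)) := Real.sq_sqrt (le_max_left _ _)
  have hρ1 : ρ < 1 := by
    rw [hρ, Real.sqrt_lt' one_pos]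
    exact max_lt (by norm_num) (by linarith)
  have hLρ : 0 < L * (1 - ρ) / 2 := by
    have : 0 < 1 - ρ := by linarith
    positivity
  -- `δ₁ ≤ 1` turns the linear bound of `δ` into one of `δ²`, so that `(cq δ)²` is at most `κ / 2`
  -- and `L (1 - ρ) / 2`.
  refine ⟨ρ, (1 + ρ) / 2, min 1 (min (κ / 2) (L * (1 - ρ) / 2) / cq ^ 2), hρ0, by linarith,
    by linarith, lt_min one_pos (by positivity), min_le_left _ _, fun δ hδ hδ₁ => ?_⟩
  have h1 : δ ≤ 1 := hδ₁.trans (min_le_left _ _)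
  have h2 : (cq * δ) ^ 2 ≤ min (κ / 2) (L * (1 - ρ) / 2) := by
    have h3 := (le_div_iff₀ (by positivity)).1 (hδ₁.trans (min_le_right _ _))
    calc (cq * δ) ^ 2 = δ * cq ^ 2 * δ := by ring
      _ ≤ δ * cq ^ 2 * 1 := by gcongr
      _ ≤ _ := by rwa [mul_one]
  constructor
  · rw [hρ2]
    refine le_trans ?_ (le_max_right _ _)
    have h4 : κ / 2 / L ≤ (κ - (cq * δ) ^ 2) / L := by
      gcongr
      linarith [h2.trans (min_le_left _ _)]
    rw [div_div] at h4
    linarith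
  · have h4 : (cq * δ) ^ 2 / L ≤ (1 - ρ) / 2 := by
      rw [div_le_iff₀ hL]
      linarith [h2.trans (min_le_right _ _)]
    linarith

theorem pow_le_of_log_div_log_le {a δ : ℝ} (ha : 0 < a) (ha1 : a < 1) (hδ : 0 < δ) {N : ℕ}
    (h : Real.log δ / Real.log a ≤ N) : a ^ N ≤ δ := by
  rw [div_le_iff_of_neg (Real.log_neg ha ha1), ← Real.log_pow] at h
  exact (Real.log_le_log_iff (by positivity) hδ).1 h

/-- The quadratic bound for the loss of an optimal parameter, at all small noise levels. -/
theorem exists_loss_le (hA : Function.Injective A) (hK : IsConvolutional φ ψ b A K)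
    (impl : Implementation) (w₀ : FinIndex J₀ J → ℝ) {L c₀ cq : ℝ} (C : ℝ) (hL : 0 < L)
    (hc₀ : 0 < c₀) (hcq : 0 < cq) :
    ∃ a : ℝ, 0 < a ∧ a < 1 ∧ ∃ σ₁ : ℝ, 0 < σ₁ ∧ ∃ c : ℝ, 0 < c ∧
      ∀ (μ : Measure ImageSpace) [IsProbabilityMeasure μ], (∀ᵐ u ∂μ, u ∈ priorBall b J C) →
      ∀ (σ : ℝ) (q : ℕ), 0 < σ → σ ≤ σ₁ →
      ∀ (ξ N : ℕ) (Θ : Set (Fin N → LayerParam J₀ J ξ)) (θ : Fin N → LayerParam J₀ J ξ),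
        IsOptimalChoice b e φ ψ K A impl w₀ L c₀ cq a μ σ q Θ θ →
        loss b e φ ψ K A q impl w₀ μ σ θ ≤ ENNReal.ofReal (c * (σ ^ (1 / 3 : ℝ)) ^ 2) := by
  obtain ⟨κ, hκ0, hκ⟩ := exists_le_norm_sq_on_span (fun I : FinIndex J₀ J => b I) hA
  obtain ⟨ρ, a, δ₁, hρ0, ha0, ha1, hδ₁0, hδ₁1, hδ₁⟩ := exists_contraction_factor hκ0 hL hcq
  have h1a : 0 < 1 - a := by linarith
  set p : ℝ := (Fintype.card (FinIndex J₀ J) : ℝ) with hp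
  have hp0 : 0 ≤ p := Nat.cast_nonneg _
  -- The reconstruction error is at most `c₁ δ + c₂ ‖A_{p,q}* ε‖`; the summand `1` below only
  -- ensures that the final constant is positive.
  set c₁ := ‖synthesis b w₀‖ + |C| + (p * c₀ + cq ^ 2 * |C|) / L / (1 - a) with hc₁
  set c₂ := 1 / L / (1 - a) with hc₂
  refine ⟨a, ha0, ha1, δ₁ ^ 3, by positivity, 2 * c₁ ^ 2 + 2 * c₂ ^ 2 * (p * ‖A‖ ^ 2) + 1,
    by positivity, fun μ _ hμ σ q hσ hσ₁ ξ N Θ θ hopt => ?_⟩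
  obtain ⟨θ₀, hθ₀, hista⟩ := hopt.ista_mem
  set δ := σ ^ (1 / 3 : ℝ) with hδ
  have hδ0 : 0 < δ := Real.rpow_pos_of_pos hσ _
  have hδ3 : σ = δ ^ 3 := by
    rw [hδ, ← Real.rpow_natCast, ← Real.rpow_mul hσ.le]
    norm_num
  have hδle : δ ≤ δ₁ := by
    rw [hδ3] at hσ₁
    exact le_of_pow_le_pow_left₀ (by norm_num) hδ₁0.le hσ₁
  have hδ1 : δ ≤ 1 := hδle.trans hδ₁1
  obtain ⟨hρ, ha⟩ := hδ₁ δ hδ0 hδle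
  have haN : a ^ N ≤ δ := pow_le_of_log_div_log_le ha0 ha1 hδ0 hopt.layers
  refine (hopt.minimal θ₀ hθ₀).trans ((loss_le_of_norm_recError_le b e (c₁ := c₁ * δ) (c₂ := c₂)
    hμ fun u hu ε => ?_).trans (ENNReal.ofReal_le_ofReal ?_))
  · have huC : ‖u‖ ≤ |C| := (norm_le_of_mem_priorBall b hu).trans (le_abs_self C)
    rw [norm_recError]
    refine (norm_iterateLayers_sub_le b e hK hL (by positivity) hρ0 hκ hρ ha ha1 hopt.resolution
      hopt.norm_le hista hu.1 ε w₀).trans ?_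
    set t := ‖ContinuousLinearMap.adjoint (discretize b e A J q) ε‖
    have h2 : (cq * δ) ^ 2 ≤ cq ^ 2 * δ := by
      calc (cq * δ) ^ 2 = cq ^ 2 * δ * δ := by ring
        _ ≤ cq ^ 2 * δ * 1 := by gcongr
        _ = _ := mul_one _
    calc _ ≤ δ * (‖synthesis b w₀‖ + |C|) +
          (t + p * (c₀ * δ) + cq ^ 2 * δ * |C|) / L / (1 - a) := by
          gcongr
          exact (norm_sub_le _ _).trans (by gcongr)
      _ = c₁ * δ + c₂ * t := by
          rw [hc₁, hc₂]
          ring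
  · have hσδ : σ ^ 2 ≤ δ ^ 2 := by
      rw [hδ3, ← pow_mul]
      exact pow_le_pow_of_le_one hδ0.le hδ1 (by norm_num)
    calc _ ≤ 2 * (c₁ * δ) ^ 2 + 2 * c₂ ^ 2 * (p * (δ ^ 2 * ‖A‖ ^ 2)) + δ ^ 2 := by
          have := sq_nonneg δ
          refine le_add_of_le_of_nonneg ?_ this
          gcongr
      _ = _ := by ring

end Loss

theorem _root_.ENNReal.le_add_inv_mul_sq {d : ℝ≥0∞} (h0 : d ≠ 0) (htop : d ≠ ∞) (x : ℝ≥0∞) :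
    x ≤ d + d⁻¹ * x ^ 2 := by
  rcases le_total x d with h | h
  · exact h.trans le_self_add
  · calc x = d⁻¹ * (d * x) := by rw [← mul_assoc, ENNReal.inv_mul_cancel h0 htop, one_mul]
      _ ≤ d⁻¹ * (x * x) := by gcongr
      _ ≤ d + d⁻¹ * x ^ 2 := by rw [← sq]; exact le_add_self

/-- Bounds of order `δ²` for the second moment yield bounds of order `δ` for the mean, without any
measurability. -/
theorem lintegral_le_of_lintegral_sq_le {α : Type*} [MeasurableSpace α] {μ : Measure α}
    [IsProbabilityMeasure μ] {f : α → ℝ≥0∞} {c δ : ℝ} (hδ : 0 < δ) (hc : 0 ≤ c)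
    (h : ∫⁻ x, f x ^ 2 ∂μ ≤ ENNReal.ofReal (c * δ ^ 2)) :
    ∫⁻ x, f x ∂μ ≤ ENNReal.ofReal ((1 + c) * δ) := by
  have h0 : ENNReal.ofReal δ ≠ 0 := by simpa using hδ
  calc ∫⁻ x, f x ∂μ ≤ ∫⁻ x, (ENNReal.ofReal δ + (ENNReal.ofReal δ)⁻¹ * f x ^ 2) ∂μ :=
        lintegral_mono fun x => ENNReal.le_add_inv_mul_sq h0 ENNReal.ofReal_ne_top _
    _ = ENNReal.ofReal δ + (ENNReal.ofReal δ)⁻¹ * ∫⁻ x, f x ^ 2 ∂μ := by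
        rw [lintegral_add_left measurable_const, lintegral_const, measure_univ, mul_one,
          lintegral_const_mul' _ _ (ENNReal.inv_ne_top.2 h0)]
    _ ≤ ENNReal.ofReal δ + (ENNReal.ofReal δ)⁻¹ * ENNReal.ofReal (c * δ ^ 2) := by gcongr
    _ = ENNReal.ofReal ((1 + c) * δ) := by
        rw [← ENNReal.ofReal_inv_of_pos hδ, ← ENNReal.ofReal_mul (by positivity),
          ← ENNReal.ofReal_add hδ.le (by positivity)]
        congr 1
        field_simp

end PsiDONet

end

theorem mainTheorem3
    {Y : Type*} [NormedAddCommGroup Y] [InnerProductSpace ℝ Y] [CompleteSpace Y]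
    [MeasurableSpace Y] [BorelSpace Y]
    (e : HilbertBasis ℕ ℝ Y)
    (J₀ J : ℕ) (hJ : J₀ < J)
    (φ ψ : ℝ → ℝ) (b : HilbertBasis (PsiDONet.WaveletIndex J₀) ℝ PsiDONet.ImageSpace)
    (hb : PsiDONet.IsWaveletBasis φ ψ b)
    (A : PsiDONet.ImageSpace →L[ℝ] Y) (hA : Function.Injective A)
    (K : ℝ × ℝ → ℝ) (hK : PsiDONet.IsConvolutional φ ψ b A K)
    (impl : PsiDONet.Implementation) (w₀ : PsiDONet.FinIndex J₀ J → ℝ)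
    (L c₀ cq C : ℝ) (hL : 0 < L) (hc₀ : 0 < c₀) (hcq : 0 < cq) :
    ∃ a : ℝ, 0 < a ∧ a < 1 ∧
      (∃ σ₁ : ℝ, 0 < σ₁ ∧ ∃ c : ℝ, 0 < c ∧
        ∀ (μ : Measure PsiDONet.ImageSpace) [IsProbabilityMeasure μ],
          (∀ᵐ u ∂μ, u ∈ PsiDONet.priorBall b J C) →
        ∀ (σ : ℝ) (q : ℕ), 0 < σ → σ ≤ min σ₁ √(q : ℝ) →
        ∀ (ξ N : ℕ) (Θ : Set (Fin N → PsiDONet.LayerParam J₀ J ξ))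
          (θ : Fin N → PsiDONet.LayerParam J₀ J ξ),
          PsiDONet.IsOptimalChoice b e φ ψ K A impl w₀ L c₀ cq a μ σ q Θ θ →
          PsiDONet.loss b e φ ψ K A q impl w₀ μ σ θ ≤
            ENNReal.ofReal (c * (σ ^ (1 / 3 : ℝ)) ^ 2)) ∧
      (∀ (μ : Measure PsiDONet.ImageSpace) [IsProbabilityMeasure μ],
          (∀ᵐ u ∂μ, u ∈ PsiDONet.priorBall b J C) →
        ∀ (ι : Type) (l : Filter ι) (σ : ι → ℝ), Tendsto σ l (𝓝[>] 0) →
        ∀ (q ξ N : ι → ℕ) (Θ : ∀ i, Set (Fin (N i) → PsiDONet.LayerParam J₀ J (ξ i)))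
          (θ : ∀ i, Fin (N i) → PsiDONet.LayerParam J₀ J (ξ i)),
          (∀ᶠ i in l, PsiDONet.IsOptimalChoice b e φ ψ K A impl w₀ L c₀ cq a μ (σ i)
            (q i) (Θ i) (θ i)) →
          Tendsto (fun i => ∫⁻ z, ‖PsiDONet.recError b e φ ψ K A (q i) impl w₀ (θ i) z.1 z.2‖ₑ
              ∂(μ.prod (PsiDONet.gaussianNoise e (q i) (σ i)))) l (𝓝 0)) := by
  obtain ⟨a, ha0, ha1, σ₁, hσ₁, c, hc, h⟩ := PsiDONet.exists_loss_le b e hA hK impl w₀ C hL hc₀ hcq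
  refine ⟨a, ha0, ha1, ⟨σ₁, hσ₁, c, hc, fun μ _ hμ σ q hσ hσq =>
    h μ hμ σ q hσ (hσq.trans (min_le_left _ _))⟩, ?_⟩
  intro μ _ hμ ι l σ hσ q ξ N Θ θ hopt
  -- The loss bound `c δ²` gives `(1 + c) δ` for the mean error.
  have hlim : Tendsto (fun i => ENNReal.ofReal ((1 + c) * σ i ^ (1 / 3 : ℝ))) l (𝓝 0) := by
    have h1 : Tendsto (fun i => σ i ^ (1 / 3 : ℝ)) l (𝓝 0) := by
      simpa using (tendsto_nhdsWithin_iff.1 hσ).1.rpow_const (p := (1 / 3 : ℝ))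
        (Or.inr (by norm_num))
    simpa using ENNReal.tendsto_ofReal (h1.const_mul (1 + c))
  refine tendsto_of_tendsto_of_tendsto_of_le_of_le' tendsto_const_nhds hlim
    (.of_forall fun _ => zero_le) ?_
  filter_upwards [hopt, hσ (Ioc_mem_nhdsGT hσ₁)] with i hi hσi
  exact PsiDONet.lintegral_le_of_lintegral_sq_le (Real.rpow_pos_of_pos hσi.1 _) hc.le
    (h μ hμ (σ i) (q i) hσi.1 hσi.2 (ξ i) (N i) (Θ i) (θ i) hi)
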